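/- Let $\mathbb{F}$ be a division ring, $\sigma:\mathbb{F}\to\mathbb{F}$ a surjective ring endomorphism and $\delta:\mathbb{F}\to\mathbb{F}$ a $\sigma$-derivation (that is, $\delta$ is additive and $\delta(ab)=\sigma(a)\delta(b)+\delta(a)b$). Let $\mathbb{F}[x;\sigma,\delta]$ be the skew polynomial ring, with left $\mathbb{F}$-basis $\{x^i : i\in\mathbb{N}\}$ and product determined by $xa=\sigma(a)x+\delta(a)$ for $a \in \mathbb{F}$. An element $a\in\mathbb{F}$ is a (right) zero of a skew polynomial $G$ if $x-a$ divides $G$ on the right, i.e. $G=Q(x-a)$ for some $Q \in \mathbb{F}[x;\sigma,\delta]$. For $a\in\mathbb{F}$ and $\beta\in\mathbb{F}^*$ put $$a^\beta=\sigma(\beta)a\beta^{-1}+\delta(\beta)\beta^{-1},$$ and let $\{a^\beta : \beta\in\mathbb{F}^*\}$ be the conjugacy class of $a$; it is called algebraic if all its elements are zeros of one common nonzero skew polynomial. Put $\mathcal{D}_a(\beta)=\sigma(\beta)a+\delta(\beta)$ for $a,\beta\in\mathbb{F}$. For a sequence $\mathbf{a}=(a_1,\ldots,a_r) \in \mathbb{F}^r$,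 $r \geq 1$, put $$P_{\mathbf{a}}=(x-a_r)\cdots(x-a_2)(x-a_1),$$ and call $\mathbf{a}$ a $(\sigma,\delta)$-multiplicity sequence if $a_1$ is the only zero of $P_{\mathbf{a}}$. **Theorem.** Assume that $\sigma$ is surjective and that all conjugacy classes are algebraic. Let $r\ge 2$ and $\mathbf{a}=(a_1,\ldots,a_r)\in\mathbb{F}^r$. The following are equivalent: 1. $\mathbf{a}$ is a $(\sigma,\delta)$-multiplicity sequence, that is, $a_1$ is the only (right) zero of $P_{\mathbf{a}}$. 2. If $b_1,\ldots,b_r\in\mathbb{F}$ satisfy $P_{\mathbf{a}}=(x-b_r)\cdots(x-b_1)$, then $b_i=a_i$ for $i=1,\ldots,r$. 3. The pair $(a_i,a_{i+1})$ is a $(\sigma,\delta)$-multiplicity sequence for $i=1,\ldots,r-1$. 4. For $i=1,\ldots,r-1$ there exists $\beta_i\in\mathbb{F}^*$ such that $a_{i+1}=a_i^{\beta_i}$ and $\beta_i\notin\{\mathcal{D}_{a_i}(\beta)-a_i\beta : \beta\in\mathbb{F}\}$. 5. $x-a_r$ is the only skew polynomial of the form $x-b$, $b\in\mathbb{F}$,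 that divides $P_{\mathbf{a}}$ on the left (i.e. $P_{\mathbf{a}}=(x-b)Q$ for some $Q \in \mathbb{F}[x;\sigma,\delta]$). Moreover, for $i=1,\ldots,r-1$, $\{(a_i^\beta-a_i)\beta : \beta\in\mathbb{F}\}=\{\mathcal{D}_{a_i}(\beta)-a_i\beta : \beta\in\mathbb{F}\}$, where the element $(a_i^\beta-a_i)\beta$ is read as $0$ for $\beta=0$. -/

import Mathlib

universe u

/-- A `σ`-derivation of a division ring `F`: an additive map `δ : F → F` with
`δ (a * b) = σ a * δ b + δ a * b`. -/
structure SkewDerivation {F : Type u} [DivisionRing F] (σ : F →+* F) extends F →+ F where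
  leibniz : ∀ a b : F, toFun (a * b) = σ a * toFun b + toFun a * b

/-- The underlying left vector space of the skew polynomial ring `F[x; σ, δ]`: finitely supported
coefficient sequences, where `f` stands for `∑ i, f i * x ^ i`. -/
def SkewPoly {F : Type u} [DivisionRing F] (σ : F →+* F) (_δ : SkewDerivation σ) : Type u :=
  ℕ →₀ F

namespace SkewPoly

variable {F : Type u} [DivisionRing F] {σ : F →+* F} {δ : SkewDerivation σ}

noncomputable instance instAddCommGroup : AddCommGroup (SkewPoly σ δ) :=
  inferInstanceAs (AddCommGroup (ℕ →₀ F))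

noncomputable instance instModule : Module F (SkewPoly σ δ) :=
  inferInstanceAs (Module F (ℕ →₀ F))

/-- The monomial `c * x ^ i`. -/
noncomputable def monomial (i : ℕ) : F →+ SkewPoly σ δ := Finsupp.singleAddHom i

/-- Left multiplication by `x`: it sends `c * x ^ i` to `σ c * x ^ (i + 1) + δ c * x ^ i`. -/
noncomputable def xMul : SkewPoly σ δ →+ SkewPoly σ δ :=
  Finsupp.liftAddHom fun i : ℕ =>
    (monomial (i + 1) : F →+ SkewPoly σ δ).comp σ.toAddMonoidHom
      + (monomial i : F →+ SkewPoly σ δ).comp δ.toAddMonoidHom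

/-- Left multiplication by `f = ∑ i, f i * x ^ i`: it sends `g` to `∑ i, f i • x ^ i * g`, where
`x ^ i * g` is obtained from `g` by multiplying by `x` on the left `i` times. -/
noncomputable def mulHom : SkewPoly σ δ →+ SkewPoly σ δ →+ SkewPoly σ δ :=
  Finsupp.liftAddHom fun i : ℕ =>
    { toFun := fun c =>
        { toFun := fun g => c • (xMul : SkewPoly σ δ →+ SkewPoly σ δ)^[i] g
          map_zero' := by rw [iterate_map_zero, smul_zero]
          map_add' := fun g h => by rw [iterate_map_add, smul_add] }
      map_zero' := by ext1 g; exact zero_smul F _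
      map_add' := fun c d => by ext1 g; exact add_smul c d _ }

noncomputable instance instMul : Mul (SkewPoly σ δ) := ⟨fun f g => mulHom f g⟩

noncomputable instance instOne : One (SkewPoly σ δ) := ⟨monomial 0 1⟩

theorem mul_def (f g : SkewPoly σ δ) : f * g = mulHom f g := rfl

theorem addHom_ext {A : Type*} [AddCommMonoid A] {φ ψ : SkewPoly σ δ →+ A}
    (h : ∀ i c, φ (monomial i c) = ψ (monomial i c)) : φ = ψ :=
  Finsupp.addHom_ext h

theorem xMul_monomial (i : ℕ) (c : F) :
    xMul (monomial i c : SkewPoly σ δ)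
      = monomial (i + 1) (σ c) + monomial i (δ.toAddMonoidHom c) :=
  Finsupp.liftAddHom_apply_single _ i c

theorem monomial_mul (i : ℕ) (c : F) (g : SkewPoly σ δ) :
    monomial i c * g = c • xMul^[i] g :=
  DFunLike.congr_fun (Finsupp.liftAddHom_apply_single _ i c) g

theorem smul_monomial (c d : F) (i : ℕ) :
    c • (monomial i d : SkewPoly σ δ) = monomial i (c * d) :=
  Finsupp.smul_single c i d

theorem add_mul_aux (f g h : SkewPoly σ δ) : (f + g) * h = f * h + g * h := by
  simp only [mul_def, map_add, AddMonoidHom.add_apply]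

theorem mul_add_aux (f g h : SkewPoly σ δ) : f * (g + h) = f * g + f * h := by
  simp only [mul_def, map_add]

theorem xMul_smul (c : F) (g : SkewPoly σ δ) :
    xMul (c • g) = σ c • xMul g + δ.toAddMonoidHom c • g := by
  have h : (xMul : SkewPoly σ δ →+ SkewPoly σ δ).comp (DistribSMul.toAddMonoidHom _ c)
      = (DistribSMul.toAddMonoidHom _ (σ c)).comp xMul
        + DistribSMul.toAddMonoidHom _ (δ.toAddMonoidHom c) := by
    refine addHom_ext fun i d => ?_
    simp only [AddMonoidHom.comp_apply, AddMonoidHom.add_apply, DistribSMul.toAddMonoidHom_apply,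
      smul_monomial, xMul_monomial, smul_add, map_mul]
    rw [show δ.toAddMonoidHom (c * d) = σ c * δ.toAddMonoidHom d + δ.toAddMonoidHom c * d from
      δ.leibniz c d, map_add]
    abel
  exact DFunLike.congr_fun h g

theorem smul_mul_aux (c : F) (f g : SkewPoly σ δ) : (c • f) * g = c • (f * g) := by
  have h : ((mulHom : SkewPoly σ δ →+ _).flip g).comp (DistribSMul.toAddMonoidHom _ c)
      = (DistribSMul.toAddMonoidHom _ c).comp ((mulHom : SkewPoly σ δ →+ _).flip g) := by
    refine addHom_ext fun i d => ?_
    simp only [AddMonoidHom.comp_apply, DistribSMul.toAddMonoidHom_apply, smul_monomial,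
      AddMonoidHom.flip_apply, ← mul_def, monomial_mul, mul_smul]
  exact DFunLike.congr_fun h f

theorem xMul_mul (f g : SkewPoly σ δ) : xMul f * g = xMul (f * g) := by
  have h : ((mulHom : SkewPoly σ δ →+ _).flip g).comp xMul
      = xMul.comp ((mulHom : SkewPoly σ δ →+ _).flip g) := by
    refine addHom_ext fun i d => ?_
    simp only [AddMonoidHom.comp_apply, xMul_monomial,
      AddMonoidHom.flip_apply, ← mul_def, monomial_mul, add_mul_aux, xMul_smul,
      Function.iterate_succ_apply']
  exact DFunLike.congr_fun h f

theorem pow_xMul_mul (i : ℕ) (f g : SkewPoly σ δ) :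
    xMul^[i] f * g = xMul^[i] (f * g) := by
  induction i with
  | zero => rfl
  | succ i ih =>
    rw [Function.iterate_succ_apply', Function.iterate_succ_apply']
    exact (xMul_mul _ g).trans (congrArg xMul ih)

theorem mul_assoc_aux (f g h : SkewPoly σ δ) : f * g * h = f * (g * h) := by
  have H : ((mulHom : SkewPoly σ δ →+ _).flip h).comp ((mulHom : SkewPoly σ δ →+ _).flip g)
      = (mulHom : SkewPoly σ δ →+ _).flip (g * h) := by
    refine addHom_ext fun i d => ?_
    simp only [AddMonoidHom.comp_apply, AddMonoidHom.flip_apply, ← mul_def, monomial_mul,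
      smul_mul_aux, pow_xMul_mul]
  exact DFunLike.congr_fun H f

theorem delta_one (δ : SkewDerivation σ) : δ.toAddMonoidHom 1 = 0 := by
  have h : δ.toAddMonoidHom (1 * 1) = σ 1 * δ.toAddMonoidHom 1 + δ.toAddMonoidHom 1 * 1 :=
    δ.leibniz 1 1
  simpa using h

theorem pow_xMul_one (i : ℕ) :
    xMul^[i] (monomial 0 1 : SkewPoly σ δ) = monomial i 1 := by
  induction i with
  | zero => rfl
  | succ i ih =>
    rw [Function.iterate_succ_apply']
    refine (congrArg xMul ih).trans ?_
    rw [xMul_monomial, delta_one, map_one, map_zero, add_zero]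

theorem one_mul_aux (f : SkewPoly σ δ) : 1 * f = f :=
  (monomial_mul 0 1 f).trans (one_smul F f)

theorem mul_one_aux (f : SkewPoly σ δ) : f * 1 = f := by
  have H : (mulHom : SkewPoly σ δ →+ _).flip 1 = AddMonoidHom.id _ := by
    refine addHom_ext fun i d => ?_
    simp only [AddMonoidHom.flip_apply, ← mul_def, monomial_mul, AddMonoidHom.id_apply]
    rw [show (1 : SkewPoly σ δ) = monomial 0 1 from rfl, pow_xMul_one, smul_monomial, mul_one]
  exact DFunLike.congr_fun H f

/-- The skew polynomial ring `F[x; σ, δ]`. -/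
noncomputable instance instRing : Ring (SkewPoly σ δ) :=
  { instAddCommGroup, instMul, instOne with
    left_distrib := mul_add_aux
    right_distrib := add_mul_aux
    zero_mul := fun f => by simp only [mul_def, map_zero, AddMonoidHom.zero_apply]
    mul_zero := fun f => by simp only [mul_def, map_zero]
    mul_assoc := mul_assoc_aux
    one_mul := one_mul_aux
    mul_one := mul_one_aux }

/-- The constant skew polynomial `a`. -/
noncomputable def C (a : F) : SkewPoly σ δ := monomial 0 a

/-- The variable `x`. -/
noncomputable def X : SkewPoly σ δ := monomial 1 1

/-- The commutation rule `x a = σ(a) x + δ(a)` that determines the product. -/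
theorem X_mul_C (a : F) :
    (X * C a : SkewPoly σ δ) = C (σ a) * X + C (δ.toAddMonoidHom a) := by
  simp only [X, C, monomial_mul, Function.iterate_one, Function.iterate_zero_apply, one_smul]
  refine (xMul_monomial 0 a).trans ?_
  rw [smul_monomial, mul_one]

/-- Monomials are what their name says, so the powers of `x` form a left `F`-basis. -/
theorem C_mul_X_pow (c : F) (i : ℕ) : (C c * X ^ i : SkewPoly σ δ) = monomial i c := by
  have h : ∀ i : ℕ, (X ^ i : SkewPoly σ δ) = monomial i 1 := by
    intro i
    induction i with
    | zero => rfl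
    | succ i ih =>
      rw [pow_succ', ih, X, monomial_mul, Function.iterate_one, one_smul]
      refine (xMul_monomial i 1).trans ?_
      rw [delta_one, map_one, map_zero, add_zero]
  rw [h, C, monomial_mul, Function.iterate_zero_apply, smul_monomial, mul_one]

/-- `f` divides `g` on the right: `g = q * f` for some `q`. -/
def RightDvd (f g : SkewPoly σ δ) : Prop := ∃ q : SkewPoly σ δ, g = q * f

/-- `f` divides `g` on the left: `g = f * q` for some `q`. -/
def LeftDvd (f g : SkewPoly σ δ) : Prop := ∃ q : SkewPoly σ δ, g = f * q

/-- `a` is a (right) zero of `f`: the remainder of `f` in the right division by `x - a` is zero,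
that is, `x - a` divides `f` on the right. -/
def IsZero (f : SkewPoly σ δ) (a : F) : Prop := RightDvd (X - C a) f

/-- The skew polynomials vanishing at all points of `Ω`. -/
def vanishing (σ : F →+* F) (δ : SkewDerivation σ) (Ω : Set F) : Set (SkewPoly σ δ) :=
  {f | ∀ a ∈ Ω, IsZero f a}

/-- `Ω` is algebraic: some nonzero skew polynomial vanishes on `Ω`. -/
def IsAlgebraicSet (σ : F →+* F) (δ : SkewDerivation σ) (Ω : Set F) : Prop :=
  vanishing σ δ Ω ≠ {0}

/-- The map `𝓓_a : β ↦ σ(β) a + δ(β)`. -/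
def opD (σ : F →+* F) (δ : SkewDerivation σ) (a β : F) : F :=
  σ β * a + δ.toAddMonoidHom β

/-- The `(σ,δ)`-conjugate `a ^ β = σ(β) a β⁻¹ + δ(β) β⁻¹` of `a` by `β ≠ 0`. -/
def conj (σ : F →+* F) (δ : SkewDerivation σ) (a β : F) : F :=
  σ β * a * β⁻¹ + δ.toAddMonoidHom β * β⁻¹

/-- The `(σ,δ)`-conjugacy class of `a`. -/
def conjClass (σ : F →+* F) (δ : SkewDerivation σ) (a : F) : Set F :=
  {b | ∃ β : F, β ≠ 0 ∧ b = conj σ δ a β}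

/-- `P_a = (x - a_r) ⋯ (x - a_2) (x - a_1)` for `a = (a_1, …, a_r)`. -/
noncomputable def seqPoly (σ : F →+* F) (δ : SkewDerivation σ) {r : ℕ} (a : Fin r → F) :
    SkewPoly σ δ :=
  (List.ofFn fun i => (X - C (a i) : SkewPoly σ δ)).reverse.prod

/-- A sequence of length `r = n + 1` is a `(σ,δ)`-multiplicity sequence: its first term is the
only zero of its skew polynomial. -/
def IsMultiplicitySeq (σ : F →+* F) (δ : SkewDerivation σ) {n : ℕ} (a : Fin (n + 1) → F) : Prop :=
  {b | IsZero (seqPoly σ δ a) b} = {a 0}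

end SkewPoly

namespace SkewPoly

/-! ### Constants, the universal property, evaluation and zeros. -/

section Basic

variable {F : Type u} [DivisionRing F] {σ : F →+* F} {δ : SkewDerivation σ}

/-! Each `c` makes `F` a left module over the skew polynomial ring, with `x` acting by `opD σ δ c`.
A nonzero `β` is killed by `f` exactly when the conjugate `c ^ β` is a zero of `f`. The action is
right linear over the centralizer of `c`, and since the class of `c` is algebraic, `F` has finite
dimension there (`finiteDimensional_centralizer`). So injectivity equals surjectivity, and
rank–nullity applies.

All conditions are compared with the statement that no consecutive pair splits, where `(a, b)`
splits if `x - a` takes the value `1` in the module of `b`. A solution `η` corresponds to the second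
zero `a + η⁻¹` of `(x - b)(x - a)`. A pair that does not split is conjugate, because `x - a` is then
not surjective, hence not injective.

If no pair splits, peeling factors off the right shows that the zero and the factorization are
unique (`isMultiplicitySeq_of_pairs`, `seqPoly_unique_of_pairs`). A split pair can be refactored,
which spoils uniqueness. That a sole zero excludes splitting is the hard point: `range_mul_eq`
compares ranges by counting dimensions (`IsMultiplicitySeq.not_splits`). For left divisors, one
direction is a descent by `exists_leftDvd_of_ne`; the other applies the hard point over the opposite
division ring. -/

@[elab_as_elim]
theorem induction_monomial {p : SkewPoly σ δ → Prop} (f : SkewPoly σ δ) (h0 : p 0)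
    (hadd : ∀ f g, p f → p g → p (f + g)) (hm : ∀ i c, p (monomial i c)) : p f :=
  Finsupp.induction_linear (motive := p) f h0 hadd hm

theorem C_mul_eq_smul (c : F) (f : SkewPoly σ δ) : C c * f = c • f :=
  monomial_mul 0 c f

theorem X_mul (f : SkewPoly σ δ) : X * f = xMul f :=
  (monomial_mul 1 1 f).trans (one_smul F _)

/-- The constants, as a ring homomorphism. -/
noncomputable def CHom (σ : F →+* F) (δ : SkewDerivation σ) : F →+* SkewPoly σ δ where
  toFun := C
  map_one' := rfl
  map_zero' := map_zero (monomial 0)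
  map_add' := map_add (monomial 0)
  map_mul' a b := by rw [C_mul_eq_smul]; exact (smul_monomial a b 0).symm

theorem C_add (a b : F) : (C (a + b) : SkewPoly σ δ) = C a + C b := map_add (CHom σ δ) a b
theorem C_sub (a b : F) : (C (a - b) : SkewPoly σ δ) = C a - C b := map_sub (CHom σ δ) a b
theorem C_mul (a b : F) : (C (a * b) : SkewPoly σ δ) = C a * C b := map_mul (CHom σ δ) a b
theorem C_zero : (C 0 : SkewPoly σ δ) = 0 := map_zero (CHom σ δ)
theorem C_one : (C 1 : SkewPoly σ δ) = 1 := rfl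

/-- The additive map underlying `lift`. -/
noncomputable def liftAdd {S : Type*} [Ring S] (ι : F →+* S) (y : S) : SkewPoly σ δ →+ S :=
  Finsupp.liftAddHom fun i : ℕ => (AddMonoidHom.mulRight (y ^ i)).comp ι.toAddMonoidHom

theorem liftAdd_monomial {S : Type*} [Ring S] (ι : F →+* S) (y : S) (i : ℕ) (c : F) :
    liftAdd ι y (monomial i c : SkewPoly σ δ) = ι c * y ^ i :=
  Finsupp.liftAddHom_apply_single _ i c

theorem liftAdd_smul {S : Type*} [Ring S] (ι : F →+* S) (y : S) (c : F) (f : SkewPoly σ δ) :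
    liftAdd ι y (c • f) = ι c * liftAdd ι y f := by
  induction f using induction_monomial with
  | h0 => simp
  | hadd f g hf hg => rw [smul_add, map_add, hf, hg, map_add, mul_add]
  | hm i d => rw [smul_monomial, liftAdd_monomial, liftAdd_monomial, map_mul, mul_assoc]

theorem liftAdd_xMul {S : Type*} [Ring S] (ι : F →+* S) (y : S)
    (h : ∀ a, y * ι a = ι (σ a) * y + ι (δ.toAddMonoidHom a)) (f : SkewPoly σ δ) :
    liftAdd ι y (xMul f) = y * liftAdd ι y f := by
  induction f using induction_monomial with
  | h0 => simp
  | hadd f g hf hg => rw [map_add, map_add, hf, hg, map_add, mul_add]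
  | hm i d =>
    rw [xMul_monomial, map_add, liftAdd_monomial, liftAdd_monomial, liftAdd_monomial,
      ← mul_assoc, h, add_mul, pow_succ', mul_assoc]

/-- The universal property of the skew polynomial ring. -/
noncomputable def lift {S : Type*} [Ring S] (ι : F →+* S) (y : S)
    (h : ∀ a, y * ι a = ι (σ a) * y + ι (δ.toAddMonoidHom a)) : SkewPoly σ δ →+* S :=
  { liftAdd ι y with
    map_one' := by
      change liftAdd ι y (monomial 0 1) = 1
      rw [liftAdd_monomial, map_one, pow_zero, one_mul]
    map_mul' := fun f g => by
      change liftAdd ι y (f * g) = liftAdd ι y f * liftAdd ι y g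
      induction f using induction_monomial with
      | h0 => simp
      | hadd f₁ f₂ h₁ h₂ => rw [add_mul, map_add, h₁, h₂, map_add, add_mul]
      | hm i c =>
        have hi : ∀ i : ℕ, liftAdd ι y (xMul^[i] g) = y ^ i * liftAdd ι y g := by
          intro i
          induction i with
          | zero => simp
          | succ i ih =>
            rw [Function.iterate_succ_apply', liftAdd_xMul ι y h, ih, pow_succ', mul_assoc]
        rw [monomial_mul, liftAdd_smul, hi, liftAdd_monomial, mul_assoc] }

theorem lift_C {S : Type*} [Ring S] (ι : F →+* S) (y : S)
    (h : ∀ a, y * ι a = ι (σ a) * y + ι (δ.toAddMonoidHom a)) (c : F) :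
    lift ι y h (C c : SkewPoly σ δ) = ι c :=
  (liftAdd_monomial ι y 0 c).trans (by rw [pow_zero, mul_one])

theorem lift_X {S : Type*} [Ring S] (ι : F →+* S) (y : S)
    (h : ∀ a, y * ι a = ι (σ a) * y + ι (δ.toAddMonoidHom a)) :
    lift ι y h (X : SkewPoly σ δ) = y :=
  (liftAdd_monomial ι y 1 1).trans (by rw [map_one, pow_one, one_mul])

/-! ### Evaluation -/

theorem delta_mul (a b : F) :
    δ.toAddMonoidHom (a * b) = σ a * δ.toAddMonoidHom b + δ.toAddMonoidHom a * b :=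
  δ.leibniz a b

theorem opD_zero (c : F) : opD σ δ c 0 = 0 := by simp [opD]

theorem opD_one (c : F) : opD σ δ c 1 = c := by simp [opD, delta_one]

theorem opD_add (c β γ : F) : opD σ δ c (β + γ) = opD σ δ c β + opD σ δ c γ := by
  simp only [opD, map_add, add_mul]; abel

theorem opD_neg (c β : F) : opD σ δ c (-β) = -opD σ δ c β := by
  simp only [opD, map_neg, neg_mul]; abel

theorem opD_mul (c a β : F) :
    opD σ δ c (a * β) = σ a * opD σ δ c β + δ.toAddMonoidHom a * β := by
  simp only [opD, map_mul, delta_mul, mul_add, mul_assoc, add_assoc]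

theorem conj_mul (c : F) {η : F} (hη : η ≠ 0) : conj σ δ c η * η = opD σ δ c η := by
  simp only [conj, opD, add_mul, mul_assoc, inv_mul_cancel₀ hη, mul_one]

theorem conj_eq_iff {c d η : F} (hη : η ≠ 0) : conj σ δ c η = d ↔ opD σ δ c η = d * η := by
  rw [← conj_mul c hη]
  exact (mul_left_inj' hη).symm

/-- Right multiplication by a conjugating element intertwines the modules of `d` and `c`. For `c =
d` this gives linearity over the centralizer. -/
theorem opD_mul_right {c d η : F} (h : opD σ δ c η = d * η) (β : F) :
    opD σ δ c (β * η) = opD σ δ d β * η := by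
  rw [opD_mul, h, opD, add_mul, mul_assoc]

theorem opD_inv {c d η : F} (hη : η ≠ 0) (h : opD σ δ c η = d * η) :
    opD σ δ d η⁻¹ = c * η⁻¹ := by
  have h1 := opD_mul_right h η⁻¹
  rw [inv_mul_cancel₀ hη, opD_one] at h1
  rw [h1, mul_assoc, mul_inv_cancel₀ hη, mul_one]

/-- The operator `opD` as an additive endomorphism. -/
noncomputable def opDHom (σ : F →+* F) (δ : SkewDerivation σ) (c : F) : AddMonoid.End F where
  toFun := opD σ δ c
  map_zero' := opD_zero c
  map_add' := opD_add c

/-- The action of the skew polynomial ring on `F` in which `x` acts by `opD σ δ c`. -/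
noncomputable def evalEnd (c : F) : SkewPoly σ δ →+* AddMonoid.End F :=
  lift (Module.toAddMonoidEnd F F) (opDHom σ δ c) fun a => by
    ext β
    exact opD_mul c a β

theorem evalEnd_C (c k β : F) : evalEnd c (C k : SkewPoly σ δ) β = k * β :=
  congrArg (fun T : AddMonoid.End F => T β) (lift_C _ _ _ k)

theorem evalEnd_X (c β : F) : evalEnd c (X : SkewPoly σ δ) β = opD σ δ c β :=
  congrArg (fun T : AddMonoid.End F => T β) (lift_X _ _ _)

theorem evalEnd_mul (c β : F) (f g : SkewPoly σ δ) :
    evalEnd c (f * g) β = evalEnd c f (evalEnd c g β) := by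
  rw [map_mul]; rfl

theorem evalEnd_add (c β : F) (f g : SkewPoly σ δ) :
    evalEnd c (f + g) β = evalEnd c f β + evalEnd c g β := by
  rw [map_add]; rfl

theorem evalEnd_X_sub_C (c a β : F) :
    evalEnd c (X - C a : SkewPoly σ δ) β = opD σ δ c β - a * β := by
  rw [map_sub, ← evalEnd_X, ← evalEnd_C c a]; rfl

theorem evalEnd_zero (c β : F) : evalEnd c (0 : SkewPoly σ δ) β = 0 := by
  rw [map_zero]; rfl

theorem evalEnd_mul_right {c d η : F} (h : opD σ δ c η = d * η) (f : SkewPoly σ δ) (β : F) :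
    evalEnd c f (β * η) = evalEnd d f β * η := by
  have hX : ∀ i : ℕ, ∀ β, evalEnd c (X ^ i : SkewPoly σ δ) (β * η)
      = evalEnd d (X ^ i : SkewPoly σ δ) β * η := by
    intro i
    induction i with
    | zero => intro β; rw [pow_zero, map_one, map_one]; rfl
    | succ i ih =>
      intro β
      rw [pow_succ', evalEnd_mul, evalEnd_mul, ih, evalEnd_X, evalEnd_X, opD_mul_right h]
  induction f using induction_monomial with
  | h0 => simp only [evalEnd_zero, zero_mul]
  | hadd f g hf hg => simp only [evalEnd_add, hf, hg, add_mul]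
  | hm i k =>
    rw [← C_mul_X_pow, evalEnd_mul, evalEnd_mul, evalEnd_C, evalEnd_C, hX, mul_assoc]

/-! ### Degrees and division on the right -/

/-- The coefficient of `x ^ i`. -/
noncomputable def coeff (i : ℕ) : SkewPoly σ δ →+ F := Finsupp.applyAddHom i

theorem coeff_monomial (i j : ℕ) (c : F) :
    coeff i (monomial j c : SkewPoly σ δ) = if j = i then c else 0 :=
  Finsupp.single_apply

theorem coeff_mul_X (i : ℕ) (f : SkewPoly σ δ) : coeff (i + 1) (f * X) = coeff i f := by
  induction f using induction_monomial with
  | h0 => simp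
  | hadd f g hf hg => rw [add_mul, map_add, hf, hg, map_add]
  | hm j c =>
    rw [← C_mul_X_pow, mul_assoc, ← pow_succ, C_mul_X_pow, C_mul_X_pow, coeff_monomial,
      coeff_monomial]
    simp

theorem coeff_C_succ (i : ℕ) (c : F) : coeff (i + 1) (C c : SkewPoly σ δ) = 0 :=
  (coeff_monomial (i + 1) 0 c).trans (if_neg (by omega))

theorem coeff_zero_C (c : F) : coeff 0 (C c : SkewPoly σ δ) = c :=
  (coeff_monomial 0 0 c).trans (if_pos rfl)

/-- `f` has degree less than `n`. -/
def DegLT : ℕ → SkewPoly σ δ → Prop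
  | 0, f => f = 0
  | n + 1, f => ∃ g k, DegLT n g ∧ f = g * X + C k

theorem DegLT.zero (n : ℕ) : DegLT n (0 : SkewPoly σ δ) := by
  induction n with
  | zero => rfl
  | succ n ih => exact ⟨0, 0, ih, by rw [zero_mul, C_zero, add_zero]⟩

theorem DegLT.succ {n : ℕ} {f : SkewPoly σ δ} (h : DegLT n f) : DegLT (n + 1) f := by
  induction n generalizing f with
  | zero => rw [show f = 0 from h]; exact DegLT.zero 1
  | succ n ih =>
    obtain ⟨g, k, hg, rfl⟩ := h
    exact ⟨g, k, ih hg, rfl⟩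

theorem DegLT.mono {n m : ℕ} {f : SkewPoly σ δ} (h : DegLT n f) (hnm : n ≤ m) : DegLT m f := by
  induction hnm with
  | refl => exact h
  | step _ ih => exact ih.succ

theorem DegLT.add {n : ℕ} {f g : SkewPoly σ δ} (hf : DegLT n f) (hg : DegLT n g) :
    DegLT n (f + g) := by
  induction n generalizing f g with
  | zero => rw [show f = 0 from hf, show g = 0 from hg]; exact add_zero 0
  | succ n ih =>
    obtain ⟨f', k, hf', rfl⟩ := hf
    obtain ⟨g', l, hg', rfl⟩ := hg
    exact ⟨f' + g', k + l, ih hf' hg', by rw [C_add, add_mul]; abel⟩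

theorem DegLT.mul_C {n : ℕ} {f : SkewPoly σ δ} (hf : DegLT n f) (a : F) :
    DegLT n (f * C a) := by
  induction n generalizing f a with
  | zero => rw [show f = 0 from hf, zero_mul]; rfl
  | succ n ih =>
    obtain ⟨g, k, hg, rfl⟩ := hf
    have h1 : DegLT (n + 1) (g * C (σ a) * X + C (k * a)) := ⟨_, _, ih hg _, rfl⟩
    have h2 := h1.add (ih hg (δ.toAddMonoidHom a)).succ
    convert h2 using 1
    rw [add_mul, mul_assoc, X_mul_C, mul_add, C_mul, mul_assoc]
    abel

theorem exists_degLT (f : SkewPoly σ δ) : ∃ n, DegLT n f := by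
  induction f using induction_monomial with
  | h0 => exact ⟨0, rfl⟩
  | hadd f g hf hg =>
    obtain ⟨n, hn⟩ := hf
    obtain ⟨m, hm⟩ := hg
    exact ⟨max n m, (hn.mono (le_max_left _ _)).add (hm.mono (le_max_right _ _))⟩
  | hm i c =>
    refine ⟨i + 1, ?_⟩
    induction i with
    | zero => exact ⟨0, c, rfl, by rw [zero_mul, zero_add]; rfl⟩
    | succ i ih =>
      refine ⟨monomial i c, 0, ih, ?_⟩
      rw [C_zero, add_zero, ← C_mul_X_pow, ← C_mul_X_pow, mul_assoc, pow_succ]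

/-- Division with remainder on the right by `x - a`. -/
theorem DegLT.exists_div {n : ℕ} {f : SkewPoly σ δ} (hf : DegLT (n + 1) f) (a : F) :
    ∃ q k, DegLT n q ∧ f = q * (X - C a) + C k := by
  induction n generalizing f with
  | zero =>
    obtain ⟨g, k, hg, rfl⟩ := hf
    exact ⟨0, k, rfl, by rw [show g = 0 from hg, zero_mul, zero_mul]⟩
  | succ n ih =>
    obtain ⟨g, k, hg, rfl⟩ := hf
    -- Since `g X = g (X - a) + g a`, only `g a`, of smaller degree, remains to be divided.
    obtain ⟨h, l, hh, e⟩ := ih (hg.mul_C a)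
    refine ⟨g + h, l + k, hg.add hh.succ, ?_⟩
    rw [C_add, add_mul, add_assoc, ← add_assoc _ (C l), ← e, mul_sub]
    abel

theorem exists_div (f : SkewPoly σ δ) (a : F) : ∃ (q : SkewPoly σ δ) (k : F), f = q * (X - C a) + C k := by
  obtain ⟨n, hn⟩ := exists_degLT f
  obtain ⟨q, k, -, h⟩ := hn.succ.exists_div a
  exact ⟨q, k, h⟩

theorem DegLT.coeff_eq_zero {n : ℕ} {f : SkewPoly σ δ} (hf : DegLT n f) : coeff n f = 0 := by
  induction n generalizing f with
  | zero => rw [show f = 0 from hf, map_zero]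
  | succ n ih =>
    obtain ⟨g, k, hg, rfl⟩ := hf
    rw [map_add, coeff_mul_X, coeff_C_succ, ih hg, add_zero]

theorem DegLT.of_coeff_eq_zero {n : ℕ} {f : SkewPoly σ δ} (hf : DegLT (n + 1) f)
    (h : coeff n f = 0) : DegLT n f := by
  induction n generalizing f with
  | zero =>
    obtain ⟨g, k, hg, rfl⟩ := hf
    rw [show g = 0 from hg, zero_mul, zero_add, coeff_zero_C] at h
    rw [show g = 0 from hg, zero_mul, zero_add, h]
    exact C_zero
  | succ n ih =>
    obtain ⟨g, k, hg, rfl⟩ := hf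
    rw [map_add, coeff_mul_X, coeff_C_succ, add_zero] at h
    exact ⟨g, k, ih hg h, rfl⟩

/-- Here `f X = f a`, and the right side has no higher degree than `f`, so the top coefficient of
`f` vanishes and the degree bound descends to `0`. -/
theorem eq_zero_of_mul_X_sub_C {f : SkewPoly σ δ} {a : F} (h : f * (X - C a) = 0) : f = 0 := by
  obtain ⟨n, hn⟩ := exists_degLT f
  induction n with
  | zero => exact hn
  | succ n ih =>
    refine ih (hn.of_coeff_eq_zero ?_)
    rw [mul_sub, sub_eq_zero] at h
    rw [← coeff_mul_X, h]
    exact (hn.mul_C a).coeff_eq_zero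

theorem mul_X_sub_C_cancel {f g : SkewPoly σ δ} {a : F}
    (h : f * (X - C a) = g * (X - C a)) : f = g :=
  sub_eq_zero.1 (eq_zero_of_mul_X_sub_C (by rw [sub_mul, h, sub_self]))

/-! ### Zeros -/

/-- In the module of `e`, `x - e` kills `1`, so the value of `f` at `1` is its remainder. -/
theorem isZero_iff {f : SkewPoly σ δ} {e : F} : IsZero f e ↔ evalEnd e f 1 = 0 := by
  constructor
  · rintro ⟨q, rfl⟩
    rw [evalEnd_mul, evalEnd_X_sub_C, opD_one, mul_one, sub_self, map_zero]
  · intro h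
    obtain ⟨q, k, rfl⟩ := exists_div f e
    rw [evalEnd_add, evalEnd_mul, evalEnd_X_sub_C, opD_one, mul_one, sub_self, map_zero,
      evalEnd_C, mul_one, zero_add] at h
    exact ⟨q, by rw [h, C_zero, add_zero]⟩

theorem evalEnd_eq_zero_iff {f : SkewPoly σ δ} {c d η : F} (hη : η ≠ 0)
    (h : opD σ δ c η = d * η) : evalEnd c f η = 0 ↔ IsZero f d := by
  have h1 := evalEnd_mul_right h f 1
  rw [one_mul] at h1
  rw [isZero_iff, h1, mul_eq_zero_iff_right hη]

theorem isZero_X_sub_C {a b : F} : IsZero (X - C a : SkewPoly σ δ) b ↔ b = a := by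
  rw [isZero_iff, evalEnd_X_sub_C, opD_one, mul_one, sub_eq_zero]

theorem IsZero.mul_left {f : SkewPoly σ δ} {a : F} (h : IsZero f a) (g : SkewPoly σ δ) :
    IsZero (g * f) a := by
  obtain ⟨q, rfl⟩ := h
  exact ⟨g * q, (mul_assoc _ _ _).symm⟩

/-- The product formula: in the module of `b`, `x - a` sends `1` to `b - a`. -/
theorem isZero_mul_X_sub_C {f : SkewPoly σ δ} {a b : F} (hab : b ≠ a) :
    IsZero (f * (X - C a)) b ↔ IsZero f (conj σ δ b (b - a)) := by
  rw [isZero_iff, evalEnd_mul, evalEnd_X_sub_C, opD_one, mul_one]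
  exact evalEnd_eq_zero_iff (sub_ne_zero.2 hab) (conj_mul b (sub_ne_zero.2 hab)).symm

end Basic

/-! ### Finite dimension over the centralizer of an algebraic class. -/

section Centralizer

variable {F : Type u} [DivisionRing F] {σ : F →+* F} {δ : SkewDerivation σ}

/-- The `(σ,δ)`-centralizer of `c`: the `k` with `opD σ δ c k = c * k`. It acts on `F` on the
right, hence it is taken inside `Fᵐᵒᵖ`. -/
noncomputable def centralizer (σ : F →+* F) (δ : SkewDerivation σ) (c : F) :
    Subfield Fᵐᵒᵖ where
  carrier := {k | opD σ δ c k.unop = c * k.unop}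
  mul_mem' {a b} ha hb := by
    change opD σ δ c (b.unop * a.unop) = c * (b.unop * a.unop)
    rw [opD_mul_right ha, show opD σ δ c b.unop = c * b.unop from hb, mul_assoc]
  one_mem' := by
    change opD σ δ c 1 = c * 1
    rw [opD_one, mul_one]
  add_mem' {a b} ha hb := by
    change opD σ δ c (a.unop + b.unop) = c * (a.unop + b.unop)
    rw [opD_add, mul_add, show opD σ δ c a.unop = c * a.unop from ha,
      show opD σ δ c b.unop = c * b.unop from hb]
  zero_mem' := by
    change opD σ δ c 0 = c * 0
    rw [opD_zero, mul_zero]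
  neg_mem' {a} ha := by
    change opD σ δ c (-a.unop) = c * -a.unop
    rw [opD_neg, mul_neg, show opD σ δ c a.unop = c * a.unop from ha]
  inv_mem' a ha := by
    change opD σ δ c a.unop⁻¹ = c * a.unop⁻¹
    by_cases h : a.unop = 0
    · rw [h, inv_zero, opD_zero, mul_zero]
    · exact opD_inv h ha

theorem mem_centralizer {c : F} {k : Fᵐᵒᵖ} :
    k ∈ centralizer σ δ c ↔ opD σ δ c k.unop = c * k.unop := Iff.rfl

/-- `evalEnd` as a right linear map over the centralizer. -/
noncomputable def evalLin (c : F) (f : SkewPoly σ δ) : F →ₗ[centralizer σ δ c] F where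
  toFun := evalEnd c f
  map_add' := map_add _
  map_smul' k β := evalEnd_mul_right (mem_centralizer.1 k.2) f β

theorem evalLin_apply (c : F) (f : SkewPoly σ δ) (β : F) : evalLin c f β = evalEnd c f β := rfl

theorem evalLin_mul (c : F) (f g : SkewPoly σ δ) :
    evalLin c (f * g) = (evalLin c f).comp (evalLin c g) :=
  LinearMap.ext fun β => evalEnd_mul c β f g

theorem mem_ker_X_sub_C {c a η : F} :
    η ∈ LinearMap.ker (evalLin c (X - C a : SkewPoly σ δ)) ↔ opD σ δ c η = a * η := by
  rw [LinearMap.mem_ker, evalLin_apply, evalEnd_X_sub_C, sub_eq_zero]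

/-- If `f` has at most one zero in the class of `c`, its kernel is at most one-dimensional. -/
theorem ker_le_span {f : SkewPoly σ δ} {c d η : F} (hη : η ≠ 0) (h : opD σ δ c η = d * η)
    (hf : ∀ b, IsZero f b → b = d) :
    LinearMap.ker (evalLin c f) ≤ Submodule.span (centralizer σ δ c) {η} := by
  intro ζ hζ
  rw [Submodule.mem_span_singleton]
  by_cases hζ0 : ζ = 0
  · exact ⟨0, by rw [hζ0, zero_smul]⟩
  have h1 : opD σ δ c ζ = conj σ δ c ζ * ζ := (conj_mul c hζ0).symm
  have h2 : conj σ δ c ζ = d := hf _ ((evalEnd_eq_zero_iff hζ0 h1).1 hζ)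
  rw [h2] at h1
  -- Both `η` and `ζ` conjugate `c` to `d`, so their quotient centralizes `c`.
  refine ⟨⟨MulOpposite.op (η⁻¹ * ζ), ?_⟩, ?_⟩
  · change opD σ δ c (η⁻¹ * ζ) = c * (η⁻¹ * ζ)
    rw [opD_mul_right h1, opD_inv hη h, mul_assoc]
  · change η * (η⁻¹ * ζ) = ζ
    rw [mul_inv_cancel_left₀ hη]

/-- A nonzero kernel vector `η` yields a right factor `x - c ^ η`. It maps the kernel of `f` into
that of the quotient, and its own kernel is a line, so the degree drops by one at the cost of one
dimension. -/
theorem DegLT.ker_fg {n : ℕ} {f : SkewPoly σ δ} (hf : DegLT n f) (hf0 : f ≠ 0) (c : F) :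
    (LinearMap.ker (evalLin c f)).FG := by
  induction n generalizing f with
  | zero => exact absurd hf hf0
  | succ n ih =>
    by_cases hker : LinearMap.ker (evalLin c f) = ⊥
    · rw [hker]; exact Submodule.fg_bot
    obtain ⟨η, hη, hη0⟩ := Submodule.exists_mem_ne_zero_of_ne_bot hker
    have h1 : opD σ δ c η = conj σ δ c η * η := (conj_mul c hη0).symm
    obtain ⟨q, k, hq, e⟩ := hf.exists_div (conj σ δ c η)
    have hk : k = 0 := by
      have h2 : evalEnd c f η = 0 := hη
      rw [e, evalEnd_add, evalEnd_mul, evalEnd_X_sub_C, ← h1, sub_self, map_zero, zero_add,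
        evalEnd_C] at h2
      exact (mul_eq_zero.1 h2).resolve_right hη0
    rw [hk, C_zero, add_zero] at e
    have hq0 : q ≠ 0 := by
      rintro rfl
      exact hf0 (by rw [e, zero_mul])
    have hfin : Module.Finite (centralizer σ δ c) (LinearMap.ker (evalLin c q)) :=
      Module.Finite.of_fg (ih hq hq0)
    refine Submodule.fg_of_fg_map_of_fg_inf_ker
      (evalLin c (X - C (conj σ δ c η) : SkewPoly σ δ)) ?_ ?_
    · refine Module.Finite.iff_fg.1 (Submodule.finiteDimensional_of_le
        (S₂ := LinearMap.ker (evalLin c q)) ?_)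
      rintro _ ⟨ζ, hζ, rfl⟩
      have h2 : evalEnd c f ζ = 0 := hζ
      rw [e, evalEnd_mul] at h2
      exact h2
    · refine Module.Finite.iff_fg.1 (Submodule.finiteDimensional_of_le
        (S₂ := Submodule.span (centralizer σ δ c) {η}) ?_)
      exact inf_le_right.trans (ker_le_span hη0 h1 fun b hb => isZero_X_sub_C.1 hb)

theorem exists_evalEnd_eq_zero {c : F} (hc : IsAlgebraicSet σ δ (conjClass σ δ c)) :
    ∃ f : SkewPoly σ δ, f ≠ 0 ∧ ∀ b ∈ conjClass σ δ c, IsZero f b := by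
  by_contra! h
  refine hc (Set.eq_singleton_iff_unique_mem.2 ⟨fun a _ => ⟨0, (zero_mul _).symm⟩, ?_⟩)
  intro f hf
  by_contra hf0
  obtain ⟨b, hb, hb'⟩ := h f hf0
  exact hb' (hf b hb)

theorem evalEnd_eq_zero_of_vanishing {c : F} {f : SkewPoly σ δ}
    (hf : ∀ b ∈ conjClass σ δ c, IsZero f b) (β : F) : evalEnd c f β = 0 := by
  by_cases hβ : β = 0
  · rw [hβ, map_zero]
  · exact (evalEnd_eq_zero_iff hβ (conj_mul c hβ).symm).2 (hf _ ⟨β, hβ, rfl⟩)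

/-- Over the centralizer of an algebraic class, `F` is finite-dimensional. -/
theorem finiteDimensional_centralizer {c : F} (hc : IsAlgebraicSet σ δ (conjClass σ δ c)) :
    FiniteDimensional (centralizer σ δ c) F := by
  obtain ⟨f, hf0, hf⟩ := exists_evalEnd_eq_zero hc
  obtain ⟨n, hn⟩ := exists_degLT f
  have h := hn.ker_fg hf0 c
  rw [show LinearMap.ker (evalLin c f) = ⊤ from
    Submodule.eq_top_iff'.2 fun β => evalEnd_eq_zero_of_vanishing hf β] at h
  exact Module.finite_def.2 h

end Centralizer

/-! ### Products of linear factors and splitting pairs. -/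

section Sequences

variable {F : Type u} [DivisionRing F] {σ : F →+* F} {δ : SkewDerivation σ}

theorem seqPoly_one (a : Fin 1 → F) : seqPoly σ δ a = X - C (a 0) := by
  simp [seqPoly]

theorem seqPoly_succ {n : ℕ} (a : Fin (n + 1) → F) :
    seqPoly σ δ a = seqPoly σ δ (Fin.tail a) * (X - C (a 0)) := by
  simp only [seqPoly, List.ofFn_succ, List.reverse_cons, List.prod_append, List.prod_singleton]
  rfl

theorem seqPoly_succ' {n : ℕ} (a : Fin (n + 1) → F) :
    seqPoly σ δ a = (X - C (a (Fin.last n))) * seqPoly σ δ (Fin.init a) := by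
  simp only [seqPoly, List.ofFn_succ', List.concat_eq_append, List.reverse_append,
    List.reverse_cons, List.reverse_nil, List.nil_append, List.prod_append, List.prod_singleton]
  rfl

theorem seqPoly_pair (a b : F) : seqPoly σ δ ![a, b] = (X - C b) * (X - C a) := by
  rw [seqPoly_succ, seqPoly_one]; rfl

theorem isZero_seqPoly_zero {n : ℕ} (a : Fin (n + 1) → F) : IsZero (seqPoly σ δ a) (a 0) :=
  ⟨_, seqPoly_succ a⟩

theorem isMultiplicitySeq_iff {n : ℕ} (a : Fin (n + 1) → F) :
    IsMultiplicitySeq σ δ a ↔ ∀ b, IsZero (seqPoly σ δ a) b → b = a 0 := by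
  constructor
  · intro h b hb
    exact (Set.ext_iff.1 h b).1 hb
  · intro h
    exact Set.eq_singleton_iff_unique_mem.2 ⟨isZero_seqPoly_zero a, h⟩

/-- The pair `(a, b)` splits: `(x - b)(x - a)` has a zero other than `a`. -/
def Splits (σ : F →+* F) (δ : SkewDerivation σ) (a b : F) : Prop :=
  ∃ η : F, opD σ δ b η - a * η = 1

theorem Splits.ne_zero {a b η : F} (h : opD σ δ b η - a * η = 1) : η ≠ 0 := by
  rintro rfl
  rw [opD_zero, mul_zero, sub_zero] at h
  exact zero_ne_one h

theorem opD_add_inv {a b η : F} (hη : η ≠ 0) :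
    opD σ δ b η = (a + η⁻¹) * η ↔ opD σ δ b η - a * η = 1 := by
  rw [add_mul, inv_mul_cancel₀ hη, sub_eq_iff_eq_add, add_comm]

theorem splits_iff {a b : F} :
    Splits σ δ a b ↔ ∃ e, e ≠ a ∧ IsZero ((X - C b) * (X - C a) : SkewPoly σ δ) e := by
  constructor
  · rintro ⟨η, h⟩
    have hη := Splits.ne_zero h
    have hne : a + η⁻¹ ≠ a := by simpa using hη
    refine ⟨a + η⁻¹, hne, (isZero_mul_X_sub_C hne).2 (isZero_X_sub_C.2 ?_)⟩
    rw [add_sub_cancel_left, conj_eq_iff (inv_ne_zero hη)]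
    exact opD_inv hη ((opD_add_inv hη).2 h)
  · rintro ⟨e, hne, h⟩
    have h1 := isZero_X_sub_C.1 ((isZero_mul_X_sub_C hne).1 h)
    have h0 := sub_ne_zero.2 hne
    have h2 := opD_inv h0 ((conj_eq_iff h0).1 h1)
    refine ⟨(e - a)⁻¹, (opD_add_inv (inv_ne_zero h0)).1 ?_⟩
    rw [inv_inv, add_sub_cancel]
    exact h2

theorem isMultiplicitySeq_pair (a b : F) :
    IsMultiplicitySeq σ δ ![a, b] ↔ ¬Splits σ δ a b := by
  rw [isMultiplicitySeq_iff, splits_iff, seqPoly_pair]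
  push Not
  exact forall_congr' fun e => not_imp_not.symm

theorem Splits.exists_factor {a b : F} (h : Splits σ δ a b) :
    ∃ d e, e ≠ a ∧ ((X - C b) * (X - C a) : SkewPoly σ δ) = (X - C d) * (X - C e) := by
  obtain ⟨e, hne, q, hq⟩ := splits_iff.1 h
  -- This `d` matches the coefficients of `x`. The two quadratics then differ by a constant, which
  -- is `0` because both vanish at `e`.
  refine ⟨b + σ (a - e), e, hne, ?_⟩
  have hX : ∀ u v : F, ((X - C u) * (X - C v) : SkewPoly σ δ)
      = X * X - C (u + σ v) * X + C (u * v - δ.toAddMonoidHom v) := by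
    intro u v
    rw [sub_mul, mul_sub, mul_sub, X_mul_C, C_add, add_mul, C_sub, C_mul]
    abel
  have h1 : b + σ a = b + σ (a - e) + σ e := by rw [map_sub]; abel
  have h2 : IsZero ((X - C b) * (X - C a) : SkewPoly σ δ) e := ⟨q, hq⟩
  have h3 : IsZero ((X - C (b + σ (a - e))) * (X - C e) : SkewPoly σ δ) e := ⟨_, rfl⟩
  rw [isZero_iff, hX, evalEnd_add, evalEnd_C, mul_one] at h2 h3
  rw [← h1] at h3
  rw [hX, hX, ← h1, add_left_cancel (h2.trans h3.symm)]

end Sequences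

/-! ### Multiplicity sequences and unique factorization. -/

section Multiplicity

variable {F : Type u} [DivisionRing F] {σ : F →+* F} {δ : SkewDerivation σ}

theorem injective_of_surjective {c : F} (hc : IsAlgebraicSet σ δ (conjClass σ δ c))
    {f : SkewPoly σ δ} (hf : Function.Surjective (evalEnd c f)) :
    Function.Injective (evalEnd c f) := by
  have := finiteDimensional_centralizer hc
  exact (LinearMap.injective_iff_surjective (f := evalLin c f)).2 hf

theorem surjective_of_injective {c : F} (hc : IsAlgebraicSet σ δ (conjClass σ δ c))
    {f : SkewPoly σ δ} (hf : Function.Injective (evalEnd c f)) :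
    Function.Surjective (evalEnd c f) := by
  have := finiteDimensional_centralizer hc
  exact (LinearMap.injective_iff_surjective (f := evalLin c f)).1 hf

theorem exists_conj_of_not_splits {a b : F} (hb : IsAlgebraicSet σ δ (conjClass σ δ b))
    (h : ¬Splits σ δ a b) : ∃ η, η ≠ 0 ∧ opD σ δ b η = a * η := by
  by_contra! hne
  refine h ?_
  have hinj : Function.Injective (evalEnd b (X - C a : SkewPoly σ δ)) := by
    refine (injective_iff_map_eq_zero _).2 fun η hη => ?_
    rw [evalEnd_X_sub_C, sub_eq_zero] at hη
    by_contra h0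
    exact hne η h0 hη
  obtain ⟨η, hη⟩ := surjective_of_injective hb hinj 1
  exact ⟨η, by rw [← evalEnd_X_sub_C]; exact hη⟩

/-- Right multiplication by `β` moves the equation with value `1` in the module of `b` to the one
with value `β` in the module of `a`. -/
theorem splits_iff_of_conj {a b β : F} (hβ : β ≠ 0) (h : opD σ δ a β = b * β) :
    Splits σ δ a b ↔ ∃ ζ, β = opD σ δ a ζ - a * ζ := by
  constructor
  · rintro ⟨η, hη⟩
    refine ⟨η * β, ?_⟩
    rw [opD_mul_right h, ← mul_assoc, ← sub_mul, hη, one_mul]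
  · rintro ⟨ζ, hζ⟩
    refine ⟨ζ * β⁻¹, ?_⟩
    rw [opD_mul_right (opD_inv hβ h), ← mul_assoc, ← sub_mul, ← hζ, mul_inv_cancel₀ hβ]

theorem not_splits_iff {a b : F} (hb : IsAlgebraicSet σ δ (conjClass σ δ b)) :
    ¬Splits σ δ a b ↔ ∃ β : F, β ≠ 0 ∧ b = conj σ δ a β ∧
      β ∉ {γ : F | ∃ η : F, γ = opD σ δ a η - a * η} := by
  constructor
  · intro h
    obtain ⟨η, hη, e⟩ := exists_conj_of_not_splits hb h
    have e' := opD_inv hη e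
    exact ⟨η⁻¹, inv_ne_zero hη, ((conj_eq_iff (inv_ne_zero hη)).2 e').symm,
      fun hm => h ((splits_iff_of_conj (inv_ne_zero hη) e').2 hm)⟩
  · rintro ⟨β, hβ, e, hm⟩ h
    exact hm ((splits_iff_of_conj hβ ((conj_eq_iff hβ).1 e.symm)).1 h)

/-- A second zero `b` would give the tail the zero `b ^ (b - a 0)`. By induction that is the second
term, so `b` is already a second zero of the first pair. -/
theorem isMultiplicitySeq_of_pairs {n : ℕ} {a : Fin (n + 1) → F}
    (h : ∀ i : Fin n, ¬Splits σ δ (a i.castSucc) (a i.succ)) : IsMultiplicitySeq σ δ a := by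
  rw [isMultiplicitySeq_iff]
  induction n with
  | zero =>
    intro b hb
    rw [seqPoly_one] at hb
    exact isZero_X_sub_C.1 hb
  | succ n ih =>
    intro b hb
    by_contra hne
    rw [seqPoly_succ, isZero_mul_X_sub_C hne] at hb
    have h1 := ih (a := Fin.tail a) (fun i => h i.succ) _ hb
    exact h 0 (splits_iff.2 ⟨b, hne, (isZero_mul_X_sub_C hne).2 (isZero_X_sub_C.2 h1)⟩)

theorem seqPoly_unique_of_pairs {n : ℕ} {a : Fin (n + 1) → F}
    (h : ∀ i : Fin n, ¬Splits σ δ (a i.castSucc) (a i.succ)) (b : Fin (n + 1) → F)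
    (hab : seqPoly σ δ a = seqPoly σ δ b) (i : Fin (n + 1)) : b i = a i := by
  have h0 : b 0 = a 0 := (isMultiplicitySeq_iff a).1 (isMultiplicitySeq_of_pairs h) _
    (hab ▸ isZero_seqPoly_zero b)
  induction n with
  | zero => rwa [Fin.fin_one_eq_zero i]
  | succ n ih =>
    refine Fin.cases h0 (fun j => ?_) i
    rw [seqPoly_succ a, seqPoly_succ b, h0] at hab
    have hab' := mul_X_sub_C_cancel hab
    have ht : ∀ i : Fin n, ¬Splits σ δ (Fin.tail a i.castSucc) (Fin.tail a i.succ) :=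
      fun i => h i.succ
    exact ih ht (Fin.tail b) hab' j ((isMultiplicitySeq_iff _).1 (isMultiplicitySeq_of_pairs ht) _
      (hab' ▸ isZero_seqPoly_zero (Fin.tail b)))

theorem exists_seqPoly_eq_of_splits {n : ℕ} (a : Fin (n + 1) → F) (i : Fin n)
    (h : Splits σ δ (a i.castSucc) (a i.succ)) :
    ∃ b : Fin (n + 1) → F, seqPoly σ δ a = seqPoly σ δ b ∧ b i.castSucc ≠ a i.castSucc := by
  induction n with
  | zero => exact i.elim0
  | succ n ih =>
    induction i using Fin.cases with
    | zero =>
      obtain ⟨d, e, hne, he⟩ := h.exists_factor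
      refine ⟨Fin.cons e (Fin.cons d (Fin.tail (Fin.tail a))), ?_, hne⟩
      rw [seqPoly_succ a, seqPoly_succ (Fin.tail a), seqPoly_succ (Fin.cons e _), Fin.tail_cons,
        seqPoly_succ (Fin.cons d _), Fin.tail_cons, Fin.cons_zero, Fin.cons_zero, mul_assoc,
        mul_assoc, ← he]
      rfl
    | succ i =>
      obtain ⟨b, hb, hne⟩ := ih (Fin.tail a) i h
      refine ⟨Fin.cons (a 0) b, ?_, hne⟩
      rw [seqPoly_succ a, seqPoly_succ (Fin.cons _ _), Fin.tail_cons, hb, Fin.cons_zero]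

/-- Pairs that do not split are conjugate; composing the conjugators supplies the `ν` needed in
`range_mul_eq`. -/
theorem exists_conj_last (hC : ∀ c : F, IsAlgebraicSet σ δ (conjClass σ δ c)) {n : ℕ}
    {a : Fin (n + 1) → F} (h : ∀ i : Fin n, ¬Splits σ δ (a i.castSucc) (a i.succ)) :
    ∃ η, η ≠ 0 ∧ opD σ δ (a 0) η = a (Fin.last n) * η := by
  induction n with
  | zero => exact ⟨1, one_ne_zero, by rw [opD_one, mul_one]; rfl⟩
  | succ n ih =>
    obtain ⟨η, hη, e⟩ := ih (a := Fin.init a) (fun i => h i.castSucc)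
    obtain ⟨ζ, hζ, e'⟩ := exists_conj_of_not_splits (hC _) (h (Fin.last n))
    have e'' := opD_inv hζ e'
    refine ⟨ζ⁻¹ * η, mul_ne_zero (inv_ne_zero hζ) hη, ?_⟩
    rw [show a 0 = Fin.init a 0 from rfl, opD_mul_right e,
      show Fin.init a (Fin.last n) = a (Fin.last n).castSucc from rfl, e'',
      mul_assoc]
    rfl

/-- If the only zero of `(x - a) * q` is conjugate to `a`, then `(x - a) * q` and `x - a` have
the same range on every finite-dimensional evaluation module. -/
theorem range_mul_eq {c a a₀ ν : F} (hc : IsAlgebraicSet σ δ (conjClass σ δ c))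
    {q : SkewPoly σ δ} (hq : ∀ b, IsZero ((X - C a) * q) b → b = a₀)
    (hν : ν ≠ 0) (h : opD σ δ a₀ ν = a * ν) :
    LinearMap.range (evalLin c ((X - C a) * q))
      = LinearMap.range (evalLin c (X - C a : SkewPoly σ δ)) := by
  have := finiteDimensional_centralizer hc
  refine Submodule.eq_of_le_of_finrank_le ?_ ?_
  · rw [evalLin_mul]
    exact LinearMap.range_comp_le_range _ _
  · have h1 := LinearMap.finrank_range_add_finrank_ker (evalLin c ((X - C a) * q))
    have h2 := LinearMap.finrank_range_add_finrank_ker (evalLin c (X - C a : SkewPoly σ δ))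
    suffices h3 : Module.finrank (centralizer σ δ c) (LinearMap.ker (evalLin c ((X - C a) * q)))
        ≤ Module.finrank (centralizer σ δ c)
          (LinearMap.ker (evalLin c (X - C a : SkewPoly σ δ))) by omega
    by_cases hker : LinearMap.ker (evalLin c ((X - C a) * q)) = ⊥
    · rw [hker, finrank_bot]; exact Nat.zero_le _
    obtain ⟨η, hη, hη0⟩ := Submodule.exists_mem_ne_zero_of_ne_bot hker
    have e : opD σ δ c η = a₀ * η := by
      have e1 := (conj_mul c hη0 : conj σ δ c η * η = _).symm
      rwa [hq _ ((evalEnd_eq_zero_iff hη0 e1).1 hη)] at e1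
    -- The kernel of the product is at most the line of `η`; `ν * η` shows that the kernel of `x -
    -- a` is then at least a line.
    have hmem : ν * η ∈ LinearMap.ker (evalLin c (X - C a : SkewPoly σ δ)) := by
      rw [mem_ker_X_sub_C, opD_mul_right e, h, mul_assoc]
    refine (Submodule.finrank_mono (ker_le_span hη0 e hq)).trans ?_
    rw [finrank_span_singleton hη0, ← finrank_span_singleton (K := centralizer σ δ c)
      (mul_ne_zero hν hη0)]
    exact Submodule.finrank_mono ((Submodule.span_singleton_le_iff_mem _ _).2 hmem)

/-- By induction only the last pair can split. Then `1` is in the range of its first factor, hence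
equals the value at some `θ` of the product of all factors but the last, in the module of the last
term `c`. As `x - c` kills `1`, `c ^ θ` is a zero of the whole product but not of the shorter one,
which vanishes at the only permitted zero. -/
theorem IsMultiplicitySeq.not_splits (hC : ∀ c : F, IsAlgebraicSet σ δ (conjClass σ δ c)) {n : ℕ}
    {a : Fin (n + 1) → F} (h : IsMultiplicitySeq σ δ a) (i : Fin n) :
    ¬Splits σ δ (a i.castSucc) (a i.succ) := by
  induction n with
  | zero => exact i.elim0
  | succ n ih =>
    rw [isMultiplicitySeq_iff] at h
    have hinit : ∀ b, IsZero (seqPoly σ δ (Fin.init a)) b → b = a 0 := fun b hb =>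
      h b (by rw [seqPoly_succ']; exact hb.mul_left _)
    have hpairs : ∀ i : Fin n, ¬Splits σ δ (Fin.init a i.castSucc) (Fin.init a i.succ) :=
      fun i => ih ((isMultiplicitySeq_iff _).2 hinit) i
    refine Fin.lastCases ?_ (fun j => hpairs j) i
    rintro ⟨η, hη⟩
    obtain ⟨ν, hν, e⟩ := exists_conj_last hC hpairs
    set c := a (Fin.last n).succ with hc
    have hfac := seqPoly_succ' (σ := σ) (δ := δ) (Fin.init a)
    have hrange := range_mul_eq (hC c) (fun b hb => hinit b (hfac ▸ hb)) hν e
    rw [← hfac] at hrange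
    have hone : (1 : F) ∈ LinearMap.range (evalLin c (seqPoly σ δ (Fin.init a))) := by
      rw [hrange]
      exact ⟨η, (evalEnd_X_sub_C c _ η).trans hη⟩
    obtain ⟨θ, hθ⟩ := hone
    rw [evalLin_apply] at hθ
    have hθ0 : θ ≠ 0 := by
      rintro rfl
      rw [map_zero] at hθ
      exact zero_ne_one hθ
    have e1 := (conj_mul c hθ0 : conj σ δ c θ * θ = _).symm
    have hz : IsZero (seqPoly σ δ a) (conj σ δ c θ) := by
      rw [← evalEnd_eq_zero_iff hθ0 e1, seqPoly_succ', evalEnd_mul, hθ, evalEnd_X_sub_C, opD_one,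
        mul_one]
      exact sub_self c
    have hz' : IsZero (seqPoly σ δ (Fin.init a)) (conj σ δ c θ) := by
      rw [h _ hz]
      exact isZero_seqPoly_zero (Fin.init a)
    rw [← evalEnd_eq_zero_iff hθ0 e1, hθ] at hz'
    exact one_ne_zero hz'

/-! ### Left divisors -/

theorem X_sub_C_mul_ne_one {c : F} (hc : IsAlgebraicSet σ δ (conjClass σ δ c)) {d η : F}
    (hη : η ≠ 0) (h : opD σ δ c η = d * η) (q : SkewPoly σ δ) : (X - C d) * q ≠ 1 := by
  intro e
  have hs : Function.Surjective (evalEnd c (X - C d : SkewPoly σ δ)) := fun β =>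
    ⟨evalEnd c q β, by rw [← evalEnd_mul, e, map_one]; rfl⟩
  refine hη (injective_of_surjective hc hs ?_)
  rw [evalEnd_X_sub_C, h, sub_self, map_zero]

/-- Subtraction gives `(x - b)(q - p) = (b - a) p`. Choose `v` with `σ v = (b - a)⁻¹` and set `c = b
^ v`; then `(x - c) v = σ(v) (x - b)`, so `(x - c) v (q - p) = p`. -/
theorem exists_leftDvd_of_ne (hσ : Function.Surjective σ) {a b : F} (hne : b ≠ a)
    {p q : SkewPoly σ δ} (h : (X - C a) * p = (X - C b) * q) :
    ∃ c, LeftDvd (X - C c) p ∧ Splits σ δ c a := by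
  have h0 : b - a ≠ 0 := sub_ne_zero.2 hne
  obtain ⟨v, hv⟩ := hσ (b - a)⁻¹
  have hv0 : v ≠ 0 := by
    rintro rfl
    rw [map_zero] at hv
    exact inv_ne_zero h0 hv.symm
  have hc : (σ v * b + δ.toAddMonoidHom v) * v⁻¹ * v = σ v * b + δ.toAddMonoidHom v := by
    rw [mul_assoc, inv_mul_cancel₀ hv0, mul_one]
  set c := (σ v * b + δ.toAddMonoidHom v) * v⁻¹
  refine ⟨c, ⟨C v * (q - p), ?_⟩, -v, ?_⟩
  · have h1 : ((X - C c) * C v : SkewPoly σ δ) = C (σ v) * (X - C b) := by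
      rw [sub_mul, X_mul_C, ← C_mul, hc, C_add, C_mul, mul_sub]
      abel
    have h2 : (X - C b) * (q - p) = C (b - a) * p := by
      rw [mul_sub, ← h, ← sub_mul, C_sub]
      congr 1
      abel
    rw [← mul_assoc, h1, mul_assoc, h2, ← mul_assoc, ← C_mul, hv, inv_mul_cancel₀ h0, C_one,
      one_mul]
  · have h1 : σ v * (b - a) = 1 := by rw [hv, inv_mul_cancel₀ h0]
    rw [opD_neg, mul_neg, hc, opD, ← h1, mul_sub]
    abel

theorem leftDvd_last_of_pairs (hσ : Function.Surjective σ)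
    (hC : ∀ c : F, IsAlgebraicSet σ δ (conjClass σ δ c)) {n : ℕ} {a : Fin (n + 1) → F}
    (h : ∀ i : Fin n, ¬Splits σ δ (a i.castSucc) (a i.succ)) {b : F}
    (hb : LeftDvd (X - C b) (seqPoly σ δ a)) : b = a (Fin.last n) := by
  by_contra hne
  obtain ⟨q, hq⟩ := hb
  rw [seqPoly_succ'] at hq
  obtain ⟨c, hc, hs⟩ := exists_leftDvd_of_ne hσ hne hq
  -- A foreign left divisor passes to ever shorter products: it either meets the preceding term,
  -- which makes a pair split, or ends up dividing the empty product `1`.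
  induction n generalizing b q c with
  | zero =>
    obtain ⟨w, hw⟩ := hc
    refine X_sub_C_mul_ne_one (hC c) one_ne_zero (by rw [opD_one, mul_one]) w (hw.symm.trans ?_)
    simp [seqPoly]
  | succ n ih =>
    by_cases hcl : c = a (Fin.last n).castSucc
    · exact h (Fin.last n) (hcl ▸ hs)
    · obtain ⟨w, hw⟩ := hc
      rw [seqPoly_succ'] at hw
      obtain ⟨d, hd, hs'⟩ := exists_leftDvd_of_ne hσ hcl hw
      exact ih (a := Fin.init a) (fun i => h i.castSucc) hcl w hw d hd hs'

theorem leftDvd_last {n : ℕ} (a : Fin (n + 1) → F) :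
    LeftDvd (X - C (a (Fin.last n))) (seqPoly σ δ a) :=
  ⟨_, seqPoly_succ' a⟩

end Multiplicity

/-! ### Passage to the opposite ring, turning left divisors into zeros. -/

section Opposite

open MulOpposite

variable {F : Type u} [DivisionRing F]

/-- The inverse of a surjective endomorphism, on the opposite ring. -/
noncomputable def opSigma (σ : F →+* F) (hσ : Function.Surjective σ) : Fᵐᵒᵖ →+* Fᵐᵒᵖ :=
  RingHom.op (RingEquiv.ofBijective σ ⟨σ.injective, hσ⟩).symm.toRingHom

theorem opSigma_op (σ : F →+* F) (hσ : Function.Surjective σ) (v : F) :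
    opSigma σ hσ (op (σ v)) = op v :=
  congrArg op ((RingEquiv.ofBijective σ ⟨σ.injective, hσ⟩).symm_apply_apply v)

/-- The derivation of the opposite ring for which `SkewPoly` is the opposite of the skew
polynomial ring of `σ` and `δ`. -/
noncomputable def opDelta {σ : F →+* F} (δ : SkewDerivation σ) (hσ : Function.Surjective σ) :
    SkewDerivation (opSigma σ hσ) where
  -- The commutation rule solved for the other side: `σ(v) x = x v - δ(v)`.
  toFun b := -op (δ.toAddMonoidHom (opSigma σ hσ b).unop)
  map_zero' := by simp
  map_add' a b := by
    rw [map_add, unop_add, map_add, op_add, neg_add]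
  leibniz a b := by
    change -op (δ.toAddMonoidHom (opSigma σ hσ (a * b)).unop) =
      opSigma σ hσ a * -op (δ.toAddMonoidHom (opSigma σ hσ b).unop)
        + -op (δ.toAddMonoidHom (opSigma σ hσ a).unop) * b
    have hb : op (σ (opSigma σ hσ b).unop) = b :=
      congrArg op ((RingEquiv.ofBijective σ ⟨σ.injective, hσ⟩).apply_symm_apply b.unop)
    rw [map_mul, unop_mul, delta_mul, op_add, op_mul, op_mul, op_unop, hb, mul_neg, neg_mul,
      neg_add, add_comm]

theorem opDelta_op {σ : F →+* F} (δ : SkewDerivation σ) (hσ : Function.Surjective σ) (v : F) :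
    (opDelta δ hσ).toAddMonoidHom (op (σ v)) = -op (δ.toAddMonoidHom v) := by
  change -op (δ.toAddMonoidHom (opSigma σ hσ (op (σ v))).unop) = _
  rw [opSigma_op, unop_op]

variable {σ : F →+* F} {δ : SkewDerivation σ} (hσ : Function.Surjective σ)

theorem opD_op (c v : F) :
    opD (opSigma σ hσ) (opDelta δ hσ) (op c) (op (σ v)) = op (c * v - δ.toAddMonoidHom v) := by
  rw [opD, opSigma_op, opDelta_op, op_sub, op_mul, sub_eq_add_neg]

/-- The canonical map from the skew polynomial ring over the opposite division ring. -/
noncomputable def ofOp (δ : SkewDerivation σ) :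
    SkewPoly (opSigma σ hσ) (opDelta δ hσ) →+* (SkewPoly σ δ)ᵐᵒᵖ :=
  lift (CHom σ δ).op (op X) fun a => by
    obtain ⟨v, hv⟩ := hσ a.unop
    obtain rfl : a = op (σ v) := by rw [hv, op_unop]
    rw [opSigma_op, opDelta_op, map_neg]
    change op (C (σ v) * X) = op (X * C v) + -op (C (δ.toAddMonoidHom v))
    rw [X_mul_C, op_add, add_neg_cancel_right]

theorem ofOp_C (a : F) : ofOp hσ δ (C (op a)) = op (C a) := lift_C _ _ _ _

theorem ofOp_X_sub_C (a : F) : ofOp hσ δ (X - C (op a)) = op (X - C a) := by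
  rw [map_sub, ofOp_C, op_sub]
  exact congrArg (· - op (C a)) (lift_X _ _ _)

theorem exists_ofOp_eq (f : SkewPoly σ δ) : ∃ g, ofOp hσ δ g = op f := by
  change op f ∈ (ofOp hσ δ).range
  induction f using induction_monomial with
  | h0 => exact zero_mem _
  | hadd f g hf hg => exact add_mem hf hg
  | hm i c =>
    rw [← C_mul_X_pow, op_mul, op_pow]
    exact mul_mem (pow_mem (RingHom.mem_range.2 ⟨X, lift_X _ _ _⟩) i)
      (RingHom.mem_range.2 ⟨_, ofOp_C hσ c⟩)

/-- Let `f` vanish on the class of `c`, and write `f = (x - d) q + k` for an opposite conjugate `d`.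
As `f` acts as zero, `k ≠ 0` would make `x - d` surjective, hence injective, on the module of `c`;
but `d` is also an ordinary conjugate of `c`, so `x - d` kills a nonzero vector. -/
theorem isAlgebraicSet_op (hC : ∀ c : F, IsAlgebraicSet σ δ (conjClass σ δ c)) (c : Fᵐᵒᵖ) :
    IsAlgebraicSet (opSigma σ hσ) (opDelta δ hσ)
      (conjClass (opSigma σ hσ) (opDelta δ hσ) c) := by
  obtain ⟨f, hf0, hf⟩ := exists_evalEnd_eq_zero (hC c.unop)
  obtain ⟨g, hg⟩ := exists_ofOp_eq hσ f
  have hg0 : g ≠ 0 := by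
    rintro rfl
    rw [map_zero] at hg
    exact hf0 (op_injective hg.symm)
  intro h
  refine hg0 ((Set.ext_iff.1 h g).1 ?_)
  rintro _ ⟨β, hβ, rfl⟩
  set d := conj (opSigma σ hσ) (opDelta δ hσ) c β with hd
  obtain ⟨q, k, e⟩ := exists_div g d
  obtain ⟨v, hv⟩ := hσ β.unop
  obtain rfl : β = op (σ v) := by rw [hv, op_unop]
  have hv0 : v ≠ 0 := by
    rintro rfl
    exact hβ (by rw [map_zero, op_zero])
  have h1 : opD σ δ d.unop v = c.unop * v := by
    have h2 := (conj_eq_iff hβ).1 hd.symm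
    rw [← op_unop c, opD_op] at h2
    have h3 := congrArg unop h2
    rw [unop_op, unop_mul, unop_op] at h3
    rw [opD, ← h3]
    exact sub_add_cancel _ _
  have h2 := opD_inv hv0 h1
  have e' : f = (X - C d.unop) * (ofOp hσ δ q).unop + C k.unop := by
    have := congrArg (fun p => (ofOp hσ δ p).unop) e
    rw [← op_unop d, ← op_unop k] at this
    simpa only [hg, map_add, map_mul, ofOp_X_sub_C, ofOp_C, unop_add, unop_mul, unop_op] using this
  suffices hk : k = 0 from ⟨q, by rw [e, hk, C_zero, add_zero]⟩
  by_contra hk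
  have hk' : k.unop ≠ 0 := fun h0 => hk (unop_injective h0)
  have hs : Function.Surjective (evalEnd c.unop (X - C d.unop : SkewPoly σ δ)) := by
    intro β
    have h3 := evalEnd_eq_zero_of_vanishing hf (-(k.unop⁻¹ * β))
    rw [e', evalEnd_add, evalEnd_mul, evalEnd_C, mul_neg, mul_inv_cancel_left₀ hk',
      ← sub_eq_add_neg, sub_eq_zero] at h3
    exact ⟨_, h3⟩
  refine inv_ne_zero hv0 (injective_of_surjective (hC c.unop) hs ?_)
  rw [evalEnd_X_sub_C, h2, sub_self, map_zero]

theorem ofOp_seqPoly {n : ℕ} (a : Fin n → F) :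
    ofOp hσ δ (seqPoly (opSigma σ hσ) (opDelta δ hσ) fun i => op (a i.rev))
      = op (seqPoly σ δ a) := by
  induction n with
  | zero => simp [seqPoly]
  | succ n ih =>
    rw [seqPoly_succ, seqPoly_succ', map_mul, ofOp_X_sub_C, op_mul, ← ih (Fin.init a), Fin.rev_zero]
    congr 3
    funext i
    simp [Fin.tail, Fin.init, Fin.rev_succ]

theorem Splits.toOpposite {a b : F} (h : Splits σ δ a b) :
    Splits (opSigma σ hσ) (opDelta δ hσ) (op b) (op a) := by
  obtain ⟨η, hη⟩ := h
  -- By `opD_op`, the opposite expression at this point is again `σ(η) b + δ(η) - a η`.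
  refine ⟨op (σ (-η)), ?_⟩
  rw [opD_op, ← op_mul, ← op_sub, ← op_one, ← hη, opD]
  congr 1
  simp only [map_neg, mul_neg, neg_mul]
  abel

/-- The hypothesis says that the reversed sequence is a multiplicity sequence over the opposite
ring, and splitting is preserved when a pair is reversed there. -/
theorem not_splits_of_leftDvd (hσ : Function.Surjective σ)
    (hC : ∀ c : F, IsAlgebraicSet σ δ (conjClass σ δ c)) {n : ℕ}
    {a : Fin (n + 1) → F}
    (h : ∀ b, LeftDvd (X - C b) (seqPoly σ δ a) → b = a (Fin.last n)) (i : Fin n) :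
    ¬Splits σ δ (a i.castSucc) (a i.succ) := by
  have hm : IsMultiplicitySeq (opSigma σ hσ) (opDelta δ hσ) fun i => op (a i.rev) := by
    rw [isMultiplicitySeq_iff]
    rintro b ⟨q, hq⟩
    have hq' := congrArg (ofOp hσ δ) hq
    rw [ofOp_seqPoly, map_mul, ← op_unop b, ofOp_X_sub_C] at hq'
    have hb := h b.unop ⟨(ofOp hσ δ q).unop, op_injective hq'⟩
    rw [Fin.rev_zero, ← hb, op_unop]
  intro hs
  refine hm.not_splits (isAlgebraicSet_op hσ hC) i.rev ?_
  simpa only [Fin.rev_castSucc, Fin.rev_succ, Fin.rev_rev] using hs.toOpposite hσ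

end Opposite

end SkewPoly

/-! ### The equivalences, with condition 3 as the hub. -/

open SkewPoly in
theorem mainTheorem2 {F : Type u} [DivisionRing F] (σ : F →+* F) (δ : SkewDerivation σ)
    (hσ : Function.Surjective σ)
    (hC : ∀ c : F, SkewPoly.IsAlgebraicSet σ δ (SkewPoly.conjClass σ δ c))
    (n : ℕ) (hn : 2 ≤ n + 1) (a : Fin (n + 1) → F) :
    [ SkewPoly.IsMultiplicitySeq σ δ a,
      ∀ b : Fin (n + 1) → F,
        SkewPoly.seqPoly σ δ a = SkewPoly.seqPoly σ δ b → ∀ i, b i = a i,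
      ∀ i : Fin n, SkewPoly.IsMultiplicitySeq σ δ ![a i.castSucc, a i.succ],
      ∀ i : Fin n, ∃ β : F, β ≠ 0 ∧ a i.succ = SkewPoly.conj σ δ (a i.castSucc) β ∧
        β ∉ {γ : F | ∃ η : F, γ =
          SkewPoly.opD σ δ (a i.castSucc) η - a i.castSucc * η},
      {b : F | SkewPoly.LeftDvd (SkewPoly.X - SkewPoly.C b) (SkewPoly.seqPoly σ δ a)}
        = {a (Fin.last n)} ].TFAE ∧
    ∀ i : Fin n,
      {γ : F | ∃ η : F, γ =
          (SkewPoly.conj σ δ (a i.castSucc) η - a i.castSucc) * η}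
        = {γ : F | ∃ η : F, γ =
          SkewPoly.opD σ δ (a i.castSucc) η - a i.castSucc * η} := by
  refine ⟨?_, fun i => ?_⟩
  · tfae_have 1 → 3 := fun h i => (isMultiplicitySeq_pair _ _).2 (h.not_splits hC i)
    tfae_have 3 → 1 := fun h =>
      isMultiplicitySeq_of_pairs fun i => (isMultiplicitySeq_pair _ _).1 (h i)
    tfae_have 3 → 2 := fun h =>
      seqPoly_unique_of_pairs fun i => (isMultiplicitySeq_pair _ _).1 (h i)
    tfae_have 2 → 3 := fun h i => (isMultiplicitySeq_pair _ _).2 fun hs => by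
      obtain ⟨b, hb, hne⟩ := exists_seqPoly_eq_of_splits a i hs
      exact hne (h b hb _)
    tfae_have 3 ↔ 4 := forall_congr' fun i =>
      (isMultiplicitySeq_pair _ _).trans (not_splits_iff (hC _))
    tfae_have 3 → 5 := fun h => Set.eq_singleton_iff_unique_mem.2 ⟨leftDvd_last a, fun b hb =>
      leftDvd_last_of_pairs hσ hC (fun i => (isMultiplicitySeq_pair _ _).1 (h i)) hb⟩
    tfae_have 5 → 3 := fun h i => (isMultiplicitySeq_pair _ _).2
      (not_splits_of_leftDvd hσ hC (fun b hb => (Set.ext_iff.1 h b).1 hb) i)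
    tfae_finish
  · refine Set.ext fun γ => exists_congr fun η => ?_
    -- At `η = 0` the conjugate is a junk value, but the factor `η` makes the product `0`, as the
    -- convention demands.
    by_cases hη : η = 0
    · rw [hη, mul_zero, opD_zero, mul_zero, sub_zero]
    · rw [sub_mul, conj_mul _ hη]
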